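/- For $n\in\mathbb N$, a *property* over $\{0,1\}^n$ is a topologically closed set $\mathcal P_n$ of probability distributions on $\{0,1\}^n$. It is *index-invariant* if for every distribution $D$ and every permutation $\sigma$ of $[n]$ we have $D\in\mathcal P_n \iff D_\sigma\in\mathcal P_n$, where $D_\sigma(w_{\sigma(1)},\dots,w_{\sigma(n)})=D(w_1,\dots,w_n)$. The VC-dimension of a distribution is the VC-dimension of its support, i.e. the largest size of a set $I\subseteq[n]$ such that every element of $\{0,1\}^I$ is the restriction to $I$ of a vector of the support. A distribution $D$ is *$\varepsilon$-far* from $\mathcal P_n$ if $\min_{D'\in\mathcal P_n} d_{EM}(D,D')>\varepsilon$ (every $D$ is far from $\emptyset$), where $d_{EM}$ is the Earth Mover Distance with respect to the normalized Hamming distance on $\{0,1\}^n$. An *adaptive algorithm* with $s$ samples and at most $q$ queries is a randomized algorithm which, for independent samples $V_1,\dots,V_s$ of an unknown distribution $D$, reads at most $q$ bits of these vectors one after another (each query, i.e. a sample index $i\in[s]$ and a position $j\in[n]$, may depend on the random coins and on the previous answers) and then accepts or rejects. It *$\varepsilon$-tests* $\mathcal P_n$ if it accepts with probability at least $2/3$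 whenever $D\in\mathcal P_n$, and rejects with probability at least $2/3$ whenever $D$ is $\varepsilon$-far from $\mathcal P_n$. **Proposition.** There is a sequence of properties $\mathcal P=(\mathcal P_n)_{n\in\mathbb N}$, with $\mathcal P_n$ a property over $\{0,1\}^n$, such that: 1. for every $n$, every $D\in\mathcal P_n$ is a point mass and hence has VC-dimension $0$; 2. for all sufficiently large $n$, $\mathcal P_n$ is not index-invariant; 3. there are fixed constants $\varepsilon\in(0,1)$ and $c>0$ such that for all sufficiently large $n$ and all $s,q\in\mathbb N$, every adaptive algorithm with $s$ samples and at most $q$ queries that $\varepsilon$-tests $\mathcal P_n$ satisfies $q\ge cn$. That is, $\varepsilon$-testing $\mathcal P$ requires $\Omega(n)$ queries, regardless of the number of samples. -/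

import Mathlib

noncomputable section

namespace HugeObject

/-- The `n`-dimensional Hamming cube `{0,1}^n`. -/
abbrev Cube (n : ℕ) : Type := Fin n → Bool

/-- Probability distributions over `{0,1}^n`, with the topology inherited from `ℝ^(2^n)`. -/
abbrev Dist (n : ℕ) : Type := stdSimplex ℝ (Cube n)

/-- The normalized Hamming distance. -/
def dH {n : ℕ} (x y : Cube n) : ℝ := (hammingDist x y : ℝ) / n

/-- Feasible points of the transportation linear program between `D₁` and `D₂`. -/
def IsTransport {n : ℕ} (D₁ D₂ : Dist n) (f : Cube n → Cube n → ℝ) : Prop :=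
  (∀ x, ∑ y, f x y = D₁ x) ∧ (∀ y, ∑ x, f x y = D₂ y) ∧ ∀ x y, 0 ≤ f x y ∧ f x y ≤ 1

/-- The Earth Mover Distance, the value of the transportation linear program.
The feasible set is never empty and the costs are nonnegative. -/
def emd {n : ℕ} (D₁ D₂ : Dist n) : ℝ :=
  sInf {c : ℝ | ∃ f, IsTransport D₁ D₂ f ∧ c = ∑ x, ∑ y, f x y * dH x y}

/-- The distance of a distribution from a property. It is `⊤` for the empty property. -/
def distToProperty {n : ℕ} (D : Dist n) (P : Set (Dist n)) : ENNReal :=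
  ⨅ D' ∈ P, ENNReal.ofReal (emd D D')

/-- `D` is `ε`-far from `P` if its distance from `P` is more than `ε`. -/
def IsFar {n : ℕ} (ε : ℝ) (D : Dist n) (P : Set (Dist n)) : Prop :=
  ENNReal.ofReal ε < distToProperty D P

/-- The distribution `D_σ`, determined by `D_σ (w ∘ σ) = D w`. -/
def permute {n : ℕ} (σ : Equiv.Perm (Fin n)) (D : Dist n) : Dist n :=
  ⟨fun v => D (v ∘ σ.symm), fun _ => stdSimplex.zero_le D _, by
    rw [← stdSimplex.sum_eq_one D]
    exact Fintype.sum_equiv (Equiv.arrowCongr σ (Equiv.refl Bool)) _ _ (fun _ => rfl)⟩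

theorem permute_apply_comp {n : ℕ} (σ : Equiv.Perm (Fin n)) (D : Dist n) (w : Cube n) :
    permute σ D (w ∘ σ) = D w := by
  change D ((w ∘ σ) ∘ σ.symm) = D w
  congr 1
  funext i
  simp

/-- A property is index-invariant if membership does not change when the indices of the
vectors are permuted. -/
def IndexInvariant {n : ℕ} (P : Set (Dist n)) : Prop :=
  ∀ (D : Dist n) (σ : Equiv.Perm (Fin n)), D ∈ P ↔ permute σ D ∈ P

open Classical in
/-- The support of `D`, a vector being identified with the set of indices at which it is `1`. -/
def supportFamily {n : ℕ} (D : Dist n) : Finset (Finset (Fin n)) :=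
  (Finset.univ.filter fun v : Cube n => D v ≠ 0).image
    fun v => Finset.univ.filter fun i => v i = true

/-- The VC-dimension of a distribution is the VC-dimension of its support. -/
def vcDim {n : ℕ} (D : Dist n) : ℕ := (supportFamily D).vcDim

/-- Deterministic adaptive algorithms on `s` sampled vectors of `{0,1}^n`. At each step the
algorithm either halts with an output (`true` is Accept, `false` is Reject), or queries the
`j`-th bit of the `i`-th sample and continues according to the answer. -/
inductive QueryTree (n s : ℕ) : Type
  | output (b : Bool) : QueryTree n s
  | query (i : Fin s) (j : Fin n) (next : Bool → QueryTree n s) : QueryTree n s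

/-- The output of the algorithm when the sampled vectors are `V`. -/
def QueryTree.eval {n s : ℕ} (V : Fin s → Cube n) : QueryTree n s → Bool
  | .output b => b
  | .query i j next => (next (V i j)).eval V

/-- The worst-case number of queries. -/
def QueryTree.depth {n s : ℕ} : QueryTree n s → ℕ
  | .output _ => 0
  | .query _ _ next => max (next false).depth (next true).depth + 1

/-- A randomized adaptive algorithm with `s` samples: the random coins select a deterministic
adaptive algorithm. -/
abbrev Algorithm (n s : ℕ) : Type := PMF (QueryTree n s)

/-- The algorithm makes at most `q` queries, whatever the coins and the samples are. -/
def Algorithm.QueriesAtMost {n s : ℕ} (A : Algorithm n s) (q : ℕ) : Prop :=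
  ∀ t ∈ A.support, t.depth ≤ q

/-- The probability, over the coins and over `s` independent samples from `D`, that the
algorithm outputs `b`. -/
def Algorithm.outputProb {n s : ℕ} (A : Algorithm n s) (D : Dist n) (b : Bool) : ℝ :=
  ∑ V : Fin s → Cube n, (∏ i, D (V i)) * ((A.map (QueryTree.eval V)) b).toReal

/-- The algorithm `ε`-tests the property `P`, with success probability at least `2/3`. -/
def Algorithm.EpsTests {n s : ℕ} (A : Algorithm n s) (ε : ℝ) (P : Set (Dist n)) : Prop :=
  (∀ D ∈ P, 2 / 3 ≤ A.outputProb D true) ∧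
    ∀ D, IsFar ε D P → 2 / 3 ≤ A.outputProb D false

end HugeObject

end

noncomputable section

namespace HugeObject

open Finset

/-! The property consists of the point masses on a small code. Samples from a point mass are all
equal, so their number is irrelevant, and with `q` queries the acceptance probability is a
polynomial of degree at most `q` in the vector. If all nontrivial Walsh characters of degree at most
`q` average to zero over the code, acceptance has the same mean over the code as over the cube
(`Algorithm.sum_code`). A tester forces mean at least 2/3 on the code, yet less than 2/3 on the
cube, since most vectors are far from a small code (`card_not_isFar_le`). With `a = n / 64`, a code
of `2 ^ (12 * a + 9)` words, repetitions allowed, comes from repeated doubling (`exists_code`). One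
extra word, if needed, destroys index-invariance (`exists_not_indexInvariant`). -/

/-- The sign `(-1)^b`. -/
def sgn (b : Bool) : ℝ := if b then -1 else 1

/-- The Walsh character of the index set `T`. -/
def walsh {n : ℕ} (T : Finset (Fin n)) (x : Cube n) : ℝ := ∏ i ∈ T, sgn (x i)

theorem sgn_xor (a b : Bool) : sgn (xor a b) = sgn a * sgn b := by
  cases a <;> cases b <;> simp [sgn]

theorem sgn_mul_self (a : Bool) : sgn a * sgn a = 1 := by
  cases a <;> simp [sgn]

theorem walsh_xor {n : ℕ} (T : Finset (Fin n)) (x y : Cube n) :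
    walsh T (fun i => xor (x i) (y i)) = walsh T x * walsh T y := by
  simp [walsh, sgn_xor, prod_mul_distrib]

theorem walsh_eq_one_or {n : ℕ} (T : Finset (Fin n)) (x : Cube n) :
    walsh T x = 1 ∨ walsh T x = -1 := by
  have h : walsh T x * walsh T x = 1 := by
    rw [walsh, ← prod_mul_distrib]
    simp [sgn_mul_self]
  exact mul_self_eq_one_iff.1 h

theorem exists_walsh_mul_sgn {n : ℕ} (T : Finset (Fin n)) (j : Fin n) :
    ∃ T' : Finset (Fin n), #T' ≤ #T + 1 ∧ ∀ x, walsh T x * sgn (x j) = walsh T' x := by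
  by_cases hj : j ∈ T
  · refine ⟨T.erase j, (card_erase_le).trans (Nat.le_succ _), fun x => ?_⟩
    rw [walsh, ← mul_prod_erase T _ hj, mul_comm, ← mul_assoc, sgn_mul_self, one_mul, walsh]
  · refine ⟨insert j T, card_insert_le _ _, fun x => ?_⟩
    rw [walsh, walsh, prod_insert hj, mul_comm]

theorem sum_walsh_eq_zero {n : ℕ} {T : Finset (Fin n)} (hT : T.Nonempty) :
    ∑ x, walsh T x = 0 := by
  obtain ⟨j, hj⟩ := hT
  set e : Cube n := fun i => decide (i = j)
  have he : walsh T e = -1 := by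
    rw [walsh, prod_eq_single_of_mem j hj]
    · simp [e, sgn]
    · intro i _ hi
      simp [e, sgn, hi]
  have hinv : Function.Involutive fun (x : Cube n) i => xor (x i) (e i) := by
    intro x
    funext i
    simp
  have h : ∑ x, walsh T x = ∑ x, walsh T x * walsh T e := by
    rw [← Equiv.sum_comp hinv.toPerm]
    exact sum_congr rfl fun x _ => walsh_xor T x e
  rw [← sum_mul, he] at h
  linarith

/-! ### Codes that annihilate low-degree characters -/

/-- Some vector has a nontrivial value on at least half of the given characters. -/
theorem exists_halving {n : ℕ} (U : Finset (Finset (Fin n))) (hU : ∅ ∉ U) :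
    ∃ g : Cube n, 2 * #{T ∈ U | walsh T g = 1} ≤ #U := by
  have h0 : ∑ g : Cube n, ∑ T ∈ U, walsh T g = 0 := by
    rw [sum_comm]
    refine sum_eq_zero fun T hT => sum_walsh_eq_zero ?_
    exact nonempty_iff_ne_empty.2 fun h => hU (h ▸ hT)
  -- The sum over `U` has mean zero over `g`, so some `g` gives at least as many values -1 as 1.
  obtain ⟨g, -, hg⟩ : ∃ g ∈ (univ : Finset (Cube n)), ∑ T ∈ U, walsh T g ≤ 0 :=
    exists_le_of_sum_le univ_nonempty (by simp [h0])
  refine ⟨g, ?_⟩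
  have h1 : ∑ T ∈ U, walsh T g = ∑ T ∈ U, (2 * (if walsh T g = 1 then 1 else 0) - 1 : ℝ) := by
    refine sum_congr rfl fun T _ => ?_
    rcases walsh_eq_one_or T g with h | h <;> rw [h] <;> norm_num
  rw [h1, sum_sub_distrib, ← mul_sum, sum_boole] at hg
  simp only [sum_const, nsmul_eq_mul, mul_one] at hg
  have h2 : (2 * #{T ∈ U | walsh T g = 1} : ℝ) ≤ #U := by linarith
  exact_mod_cast h2

/-- Fewer than `2^k` nontrivial characters vanish on average over some family of `2^k` vectors. -/
theorem exists_code {n : ℕ} (k : ℕ) (U : Finset (Finset (Fin n))) (hU : ∅ ∉ U)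
    (hk : #U < 2 ^ k) :
    ∃ (ι : Type) (_ : Fintype ι) (c : ι → Cube n),
      Fintype.card ι = 2 ^ k ∧ ∀ T ∈ U, ∑ i, walsh T (c i) = 0 := by
  induction k generalizing U with
  | zero =>
    refine ⟨Unit, inferInstance, fun _ _ => false, by simp, fun T hT => ?_⟩
    rw [pow_zero, Nat.lt_one_iff, card_eq_zero] at hk
    simp [hk] at hT
  | succ k ih =>
    obtain ⟨g, hg⟩ := exists_halving U hU
    obtain ⟨ι, _, c, hcard, hc⟩ := ih {T ∈ U | walsh T g = 1}
      (fun h => hU (mem_filter.1 h).1) (by rw [pow_succ] at hk; omega)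
    -- Adjoining the translate by `g` multiplies each character sum by `1 + walsh T g`. This kills
    -- the value -1; the induction hypothesis handles the value 1.
    refine ⟨Bool × ι, inferInstance,
      fun p => if p.1 then (fun i => xor (c p.2 i) (g i)) else c p.2,
      by simp [hcard, pow_succ, mul_comm], fun T hT => ?_⟩
    simp only [Fintype.sum_prod_type, Fintype.sum_bool, if_true, Bool.false_eq_true, if_false,
      walsh_xor, ← sum_mul]
    rcases walsh_eq_one_or T g with h | h
    · simp [hc T (mem_filter.2 ⟨hT, h⟩)]
    · rw [h]
      ring

/-! ### Acceptance probability as a low-degree polynomial -/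

/-- A functional that vanishes on all characters of degree at most `q` vanishes on the outputs
of algorithms with at most `q` queries. -/
theorem QueryTree.functional_eq_zero {n s q : ℕ} (Λ : (Cube n → ℝ) →ₗ[ℝ] ℝ)
    (hΛ : ∀ T : Finset (Fin n), #T ≤ q → Λ (walsh T) = 0) (t : QueryTree n s)
    (T : Finset (Fin n)) (hT : #T + t.depth ≤ q) :
    Λ (fun x => walsh T x * if t.eval (fun _ => x) then 1 else 0) = 0 := by
  induction t generalizing T with
  | output b =>
    cases b
    · rw [← Λ.map_zero]
      congr 1
      funext x
      simp [QueryTree.eval]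
    · simpa [QueryTree.eval] using hΛ T (by omega)
  | query i j next ih =>
    obtain ⟨T', hT', hw⟩ := exists_walsh_mul_sgn T j
    have hd : ∀ b, (next b).depth + 1 ≤ (QueryTree.query i j next).depth := by
      intro b
      cases b <;> simp [QueryTree.depth]
    set f : Bool → Finset (Fin n) → Cube n → ℝ := fun b S x =>
      walsh S x * if (next b).eval (fun _ => x) then 1 else 0 with hf
    have hfz : ∀ b, ∀ S : Finset (Fin n), #S ≤ #T + 1 → Λ (f b S) = 0 := fun b S hS =>
      ih b S (by have := hd b; omega)
    -- The branch indicators are `(1 ± sgn (x j)) / 2`, so each query raises the degree by at most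
    -- one.
    have hsplit : (fun x => walsh T x *
          if (QueryTree.query i j next).eval (fun _ => x) then 1 else 0) =
        (1 / 2 : ℝ) • (f true T + f false T) + (1 / 2 : ℝ) • (f false T' - f true T') := by
      funext x
      simp only [hf, Pi.add_apply, Pi.smul_apply, Pi.sub_apply, ← hw, smul_eq_mul, QueryTree.eval]
      rcases Bool.eq_false_or_eq_true (x j) with h | h <;> 
        simp only [h, sgn, if_true, Bool.false_eq_true, if_false] <;> ring
    rw [hsplit]
    simp [hfz _ T (Nat.le_succ _), hfz _ T' hT']

theorem outputProb_vertex {n s : ℕ} (A : Algorithm n s) (x : Cube n) (b : Bool) :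
    A.outputProb (stdSimplex.vertex x) b =
      ((A.map (QueryTree.eval fun _ => x)) b).toReal := by
  rw [Algorithm.outputProb, sum_eq_single (fun _ => x)]
  · simp
  · intro V _ hV
    obtain ⟨i, hi⟩ := Function.ne_iff.1 hV
    rw [prod_eq_zero (mem_univ i), zero_mul]
    simp [hi]
  · simp

theorem outputProb_vertex_add {n s : ℕ} (A : Algorithm n s) (x : Cube n) :
    A.outputProb (stdSimplex.vertex x) true + A.outputProb (stdSimplex.vertex x) false = 1 := by
  rw [outputProb_vertex, outputProb_vertex,
    ← ENNReal.toReal_add (PMF.apply_ne_top _ _) (PMF.apply_ne_top _ _)]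
  have h := (A.map (QueryTree.eval fun _ => x)).tsum_coe
  rw [tsum_bool, add_comm] at h
  rw [h, ENNReal.toReal_one]

theorem outputProb_nonneg {n s : ℕ} (A : Algorithm n s) (x : Cube n) (b : Bool) :
    0 ≤ A.outputProb (stdSimplex.vertex x) b := by
  rw [outputProb_vertex]
  exact ENNReal.toReal_nonneg

theorem hasSum_outputProb_vertex {n s : ℕ} (A : Algorithm n s) (x : Cube n) :
    HasSum (fun t => (A t).toReal * if t.eval (fun _ => x) then 1 else 0)
      (A.outputProb (stdSimplex.vertex x) true) := by
  have hmap : (A.map (QueryTree.eval fun _ => x)) true =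
      ∑' t, A t * if t.eval (fun _ => x) then 1 else 0 := by
    rw [PMF.map_apply]
    exact tsum_congr fun t => by cases QueryTree.eval (fun _ => x) t <;> simp
  have hne : ∑' t, (A t * if t.eval (fun _ => x) then 1 else 0) ≠ ⊤ :=
    hmap ▸ PMF.apply_ne_top _ _
  rw [outputProb_vertex, hmap, ENNReal.tsum_toReal_eq (ENNReal.ne_top_of_tsum_ne_top hne)]
  convert! ENNReal.hasSum_toReal hne using 2 with t
  rw [ENNReal.toReal_mul]
  split_ifs <;> simp

theorem Algorithm.functional_eq_zero {n s q : ℕ} (Λ : (Cube n → ℝ) →ₗ[ℝ] ℝ)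
    (hΛ : ∀ T : Finset (Fin n), #T ≤ q → Λ (walsh T) = 0) (A : Algorithm n s)
    (hA : A.QueriesAtMost q) :
    Λ (fun x => A.outputProb (stdSimplex.vertex x) true) = 0 := by
  have h : HasSum
      (fun t : QueryTree n s => fun x : Cube n =>
        (A t).toReal * if t.eval (fun _ => x) then 1 else 0)
      (fun x => A.outputProb (stdSimplex.vertex x) true) :=
    Pi.hasSum.2 fun x => hasSum_outputProb_vertex A x
  -- There are infinitely many trees, so `Λ` must pass through an infinite sum.
  have h' := h.map Λ Λ.continuous_of_finiteDimensional
  refine h'.unique ?_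
  convert hasSum_zero with t
  have h1 := Λ.map_smul (A t).toReal (fun x => walsh ∅ x * if t.eval (fun _ => x) then 1 else 0)
  have h2 : (A t).toReal •
      Λ (fun x => walsh ∅ x * if t.eval (fun _ => x) then 1 else 0) = 0 := by
    by_cases ht : t ∈ A.support
    · rw [QueryTree.functional_eq_zero Λ hΛ t ∅ (by simpa using hA t ht), smul_zero]
    · rw [PMF.mem_support_iff, not_not] at ht
      simp [ht]
  rw [h2] at h1
  simpa [walsh, Pi.smul_def] using h1

/-- Algorithms with at most `q` queries do not distinguish a uniform codeword from a uniform
vector if the nontrivial characters of degree at most `q` vanish on average over the code. -/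
theorem Algorithm.sum_code {n s q : ℕ} {ι : Type} [Fintype ι] (c : ι → Cube n)
    (hc : ∀ T : Finset (Fin n), T.Nonempty → #T ≤ q → ∑ i, walsh T (c i) = 0)
    (A : Algorithm n s) (hA : A.QueriesAtMost q) :
    (2 : ℝ) ^ n * ∑ i, A.outputProb (stdSimplex.vertex (c i)) true =
      Fintype.card ι * ∑ x, A.outputProb (stdSimplex.vertex x) true := by
  let Λ : (Cube n → ℝ) →ₗ[ℝ] ℝ :=
    (2 : ℝ) ^ n • ∑ i, LinearMap.proj (c i) - (Fintype.card ι : ℝ) • ∑ x, LinearMap.proj x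
  have hΛ : ∀ f, Λ f = (2 : ℝ) ^ n * ∑ i, f (c i) - Fintype.card ι * ∑ x, f x := by
    intro f
    simp [Λ, LinearMap.sum_apply]
  have h := Algorithm.functional_eq_zero Λ (q := q) (fun T hT => ?_) A hA
  · rw [hΛ] at h
    linarith
  · rw [hΛ]
    rcases T.eq_empty_or_nonempty with rfl | hne
    · simp [walsh, mul_comm]
    · rw [hc T hne hT, sum_walsh_eq_zero hne]
      simp

open Classical in
theorem not_epsTests_of_code {n s q : ℕ} {ε : ℝ} {ι : Type} [Fintype ι] [Nonempty ι]
    (c : ι → Cube n)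
    (hc : ∀ T : Finset (Fin n), T.Nonempty → #T ≤ q → ∑ i, walsh T (c i) = 0)
    (P : Set (Dist n)) (hP : ∀ i, stdSimplex.vertex (c i) ∈ P)
    (hnear : 2 * #{x : Cube n | ¬ IsFar ε (stdSimplex.vertex x) P} < 2 ^ n)
    (A : Algorithm n s) (hA : A.QueriesAtMost q) : ¬ A.EpsTests ε P := by
  rintro ⟨hacc, hrej⟩
  have hsum := A.sum_code c hc hA
  have hcard : (0 : ℝ) < Fintype.card ι := by exact_mod_cast Fintype.card_pos
  have h1 : (Fintype.card ι : ℝ) * (2 / 3) ≤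
      ∑ i, A.outputProb (stdSimplex.vertex (c i)) true := by
    simpa [mul_comm] using sum_le_sum fun i (_ : i ∈ univ) => hacc _ (hP i)
  -- Acceptance is at most 1/3 on far vectors and at most 1 on the others.
  have h2 : ∑ x, A.outputProb (stdSimplex.vertex x) true ≤
      ∑ x : Cube n, (1 / 3 + 2 / 3 * if ¬ IsFar ε (stdSimplex.vertex x) P then 1 else 0 : ℝ) := by
    refine sum_le_sum fun x _ => ?_
    have hadd := outputProb_vertex_add A x
    by_cases hx : IsFar ε (stdSimplex.vertex x) P
    · have := hrej _ hx
      simp only [hx, not_true_eq_false, if_false]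
      linarith
    · have := outputProb_nonneg A x false
      simp only [hx, not_false_eq_true, if_true]
      linarith
  rw [sum_add_distrib, ← mul_sum, sum_boole] at h2
  simp only [sum_const, card_univ, Fintype.card_pi, Fintype.card_bool, prod_const,
    Fintype.card_fin, nsmul_eq_mul, Nat.cast_pow, Nat.cast_ofNat] at h2
  have h3 : (2 * #{x : Cube n | ¬ IsFar ε (stdSimplex.vertex x) P} : ℝ) < 2 ^ n := by
    exact_mod_cast hnear
  have h4 : (2 : ℝ) ^ n * (Fintype.card ι * (2 / 3)) ≤
      Fintype.card ι * ∑ x, A.outputProb (stdSimplex.vertex x) true :=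
    hsum ▸ mul_le_mul_of_nonneg_left h1 (by positivity)
  have h5 : (2 : ℝ) ^ n * (2 / 3) ≤ ∑ x, A.outputProb (stdSimplex.vertex x) true :=
    le_of_mul_le_mul_left (by linarith) hcard
  linarith

/-! ### Point masses: distance, VC-dimension, permutations -/

theorem dH_nonneg {n : ℕ} (x y : Cube n) : 0 ≤ dH x y := by
  unfold dH
  positivity

theorem le_emd_vertex {n : ℕ} (x y : Cube n) :
    dH x y ≤ emd (stdSimplex.vertex x) (stdSimplex.vertex y) := by
  -- A feasible plan must be exhibited, as the infimum of the empty set would be 0.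
  refine le_csInf ⟨_, fun a b => if a = x ∧ b = y then 1 else 0, ⟨?_, ?_, ?_⟩, rfl⟩ ?_
  · intro a
    by_cases h : a = x <;> simp [h]
  · intro b
    by_cases h : b = y <;> simp [h]
  · intro a b
    dsimp only
    split_ifs <;> simp
  · rintro _ ⟨f, ⟨h1, h2, h3⟩, rfl⟩
    have hz : ∀ b, b ≠ y → f x b = 0 := by
      intro b hb
      have h := h2 b
      rw [stdSimplex.vertex_coe, Pi.single_eq_of_ne hb,
        sum_eq_zero_iff_of_nonneg fun a _ => (h3 a b).1] at h
      exact h x (mem_univ x)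
    have hxy : f x y = 1 := by
      have h := h1 x
      rw [stdSimplex.vertex_coe, Pi.single_eq_same,
        sum_eq_single y (fun b _ hb => hz b hb) (by simp)] at h
      exact h
    have hn : ∀ a b, 0 ≤ f a b * dH a b := fun a b => mul_nonneg (h3 a b).1 (dH_nonneg a b)
    calc dH x y = f x y * dH x y := by rw [hxy, one_mul]
      _ ≤ ∑ b, f x b * dH x b := single_le_sum (fun b _ => hn x b) (mem_univ y)
      _ ≤ ∑ a, ∑ b, f a b * dH a b :=
        single_le_sum (f := fun a => ∑ b, f a b * dH a b)
          (fun a _ => sum_nonneg fun b _ => hn a b) (mem_univ x)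

theorem isFar_vertex {n : ℕ} {ε δ : ℝ} (hδ : 0 < δ) (hε : ε < δ) (x : Cube n) (S : Set (Cube n))
    (h : ∀ y ∈ S, δ ≤ dH x y) : IsFar ε (stdSimplex.vertex x) (stdSimplex.vertex '' S) := by
  refine lt_of_lt_of_le ((ENNReal.ofReal_lt_ofReal_iff hδ).2 hε) ?_
  refine le_iInf₂ ?_
  rintro _ ⟨y, hy, rfl⟩
  exact ENNReal.ofReal_le_ofReal ((h y hy).trans (le_emd_vertex x y))

theorem supportFamily_vertex_card {n : ℕ} (x : Cube n) :
    #(supportFamily (stdSimplex.vertex x)) ≤ 1 := by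
  classical
  refine card_image_le.trans (card_le_one.2 ?_)
  have h : ∀ v ∈ univ.filter (fun v : Cube n => (stdSimplex.vertex x : Dist n) v ≠ 0), v = x := by
    intro v hv
    by_contra hne
    exact (mem_filter.1 hv).2 (by simp [hne])
  intro a ha b hb
  rw [h a (by convert ha), h b (by convert hb)]

theorem vcDim_vertex {n : ℕ} (x : Cube n) :
    vcDim (stdSimplex.vertex x : Dist n) = 0 := by
  rw [vcDim, Finset.vcDim, ← Nat.le_zero]
  refine Finset.sup_le fun s hs => ?_
  rw [mem_shatterer] at hs
  obtain ⟨u, hu, hsu⟩ := hs (empty_subset s)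
  obtain ⟨v, hv, hsv⟩ := hs (Subset.refl s)
  -- The traces `∅` and `s` come from the same support element, so `s = ∅`.
  rw [card_le_one.1 (supportFamily_vertex_card x) u hu v hv, hsv] at hsu
  simp [hsu]

theorem permute_vertex {n : ℕ} (σ : Equiv.Perm (Fin n)) (x : Cube n) :
    permute σ (stdSimplex.vertex x) = stdSimplex.vertex (x ∘ σ) := by
  ext v
  change (Pi.single x (1 : ℝ) : Cube n → ℝ) (v ∘ σ.symm) =
    (Pi.single (x ∘ σ) (1 : ℝ) : Cube n → ℝ) v
  rw [Pi.single_apply, Pi.single_apply]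
  congr 1
  exact propext (Equiv.comp_symm_eq σ x v)

/-- Every small set of vectors extends by at most one vector to a set of point masses that is not
index-invariant. -/
theorem exists_not_indexInvariant {n : ℕ} (S : Finset (Cube n)) (hS : #S + 2 < 2 ^ n) :
    ∃ S' : Finset (Cube n), S ⊆ S' ∧ #S' ≤ #S + 1 ∧
      ¬ IndexInvariant (stdSimplex.vertex '' (S' : Set (Cube n)) : Set (Dist n)) := by
  by_cases hinv : IndexInvariant (stdSimplex.vertex '' (S : Set (Cube n)) : Set (Dist n))
  swap
  · exact ⟨S, Subset.refl _, Nat.le_succ _, hinv⟩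
  have hmem : ∀ (S' : Finset (Cube n)) (x : Cube n),
      (stdSimplex.vertex x : Dist n) ∈ stdSimplex.vertex '' (S' : Set (Cube n)) ↔ x ∈ S' :=
    fun S' x => (stdSimplex.vertex_injective.mem_set_image).trans mem_coe
  -- A nonconstant `x` outside the invariant set `S` is moved by some transposition. Its image is
  -- neither `x` nor in `S`.
  obtain ⟨x, hx⟩ : ∃ x, x ∉ S ∪ {fun _ => false, fun _ => true} := by
    by_contra! h
    have h1 := card_le_card (fun x _ => h x : (univ : Finset (Cube n)) ⊆ _)
    have h2 := card_union_le S {fun _ => false, fun _ => true}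
    have h3 := card_le_two (a := (fun _ => false : Cube n)) (b := fun _ => true)
    simp only [card_univ, Fintype.card_pi, Fintype.card_bool, prod_const, Fintype.card_fin] at h1
    omega
  simp only [mem_union, mem_insert, mem_singleton, not_or] at hx
  obtain ⟨hxS, hx0, hx1⟩ := hx
  obtain ⟨i, hi⟩ := Function.ne_iff.1 hx0
  obtain ⟨j, hj⟩ := Function.ne_iff.1 hx1
  refine ⟨insert x S, subset_insert _ _, card_insert_le _ _, fun h => ?_⟩
  have h1 := (h (stdSimplex.vertex x) (Equiv.swap i j)).1 ((hmem _ _).2 (mem_insert_self _ _))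
  rw [permute_vertex, hmem, mem_insert] at h1
  rcases h1 with h1 | h1
  · have := congrFun h1 i
    simp_all
  · rw [← hmem, ← permute_vertex, ← hinv, hmem] at h1
    exact hxS h1

/-! ### Counting and choice of parameters -/

/-- The number of subsets of size at most `r`. -/
theorem card_small_sets_mul_le (n r : ℕ) (hr : r ≤ n) :
    #{T : Finset (Fin n) | #T ≤ r} * 16 ^ n ≤ 17 ^ n * 16 ^ r := by
  -- In the expansion of `(1 + 16) ^ n` over subsets, each small set contributes at least `16 ^ (n -
  -- r)`.
  have h := Fin.sum_pow_mul_eq_add_pow (n := n) (1 : ℕ) 16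
  have h1 : #{T : Finset (Fin n) | #T ≤ r} * 16 ^ (n - r) ≤ 17 ^ n := by
    norm_num at h
    rw [← h, ← smul_eq_mul, ← sum_const]
    refine (sum_le_sum fun T hT => ?_).trans (sum_le_sum_of_subset (filter_subset _ _))
    exact Nat.pow_le_pow_right (by norm_num) (Nat.sub_le_sub_left (mem_filter.1 hT).2 n)
  calc _ = #{T : Finset (Fin n) | #T ≤ r} * 16 ^ (n - r) * 16 ^ r := by
        rw [mul_assoc, ← pow_add, Nat.sub_add_cancel hr]
    _ ≤ _ := Nat.mul_le_mul_right _ h1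

theorem card_small_sets_le (n : ℕ) :
    #{T : Finset (Fin n) | #T ≤ n / 64} ≤ 2 ^ (12 * (n / 64) + 8) := by
  set a := n / 64 with ha
  have h := card_small_sets_mul_le n a (by omega)
  -- As `(17/16) ^ 8 ≤ 2`, the loss is at most `2 ^ (n / 8 + 1)`, and `n / 8 ≤ 8 * a + 7`.
  have h17 : (17 : ℕ) ^ n ≤ 16 ^ n * 2 ^ (8 * a + 8) := by
    have h1 : (17 : ℕ) ^ 8 ≤ 16 ^ 8 * 2 := by norm_num
    have h2 : (17 : ℕ) ^ n = (17 ^ 8) ^ (n / 8) * 17 ^ (n % 8) := by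
      rw [← pow_mul, ← pow_add, Nat.div_add_mod]
    have h3 : (16 : ℕ) ^ n = (16 ^ 8) ^ (n / 8) * 16 ^ (n % 8) := by
      rw [← pow_mul, ← pow_add, Nat.div_add_mod]
    have h4 : (17 : ℕ) ^ (n % 8) ≤ 16 ^ (n % 8) * 2 := by
      have : n % 8 < 8 := Nat.mod_lt _ (by norm_num)
      interval_cases n % 8 <;> norm_num
    calc (17 : ℕ) ^ n ≤ (16 ^ 8 * 2) ^ (n / 8) * (16 ^ (n % 8) * 2) := by
          rw [h2]
          exact Nat.mul_le_mul (Nat.pow_le_pow_left h1 _) h4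
      _ = 16 ^ n * 2 ^ (n / 8 + 1) := by
          rw [h3, mul_pow]
          ring
      _ ≤ _ := Nat.mul_le_mul_left _ (Nat.pow_le_pow_right (by norm_num) (by omega))
  have h16 : (16 : ℕ) ^ a = 2 ^ (4 * a) := by
    rw [pow_mul]
    norm_num
  refine Nat.le_of_mul_le_mul_right (h.trans ?_) (show 0 < 16 ^ n by positivity)
  calc (17 : ℕ) ^ n * 16 ^ a ≤ 16 ^ n * 2 ^ (8 * a + 8) * 2 ^ (4 * a) := by
        rw [h16]
        exact Nat.mul_le_mul_right _ h17
    _ = _ := by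
        rw [mul_assoc, ← pow_add, mul_comm]
        congr 2
        omega

theorem card_ball_le {n : ℕ} (y : Cube n) (r : ℕ) :
    #{x : Cube n | hammingDist x y ≤ r} ≤ #{T : Finset (Fin n) | #T ≤ r} := by
  refine card_le_card_of_injOn (fun x => univ.filter fun i => x i ≠ y i) ?_ ?_
  · intro x hx
    simpa [hammingDist] using hx
  · intro x _ x' _ h
    funext i
    have := Finset.ext_iff.1 h i
    simp only [mem_filter, mem_univ, true_and] at this
    revert this
    cases x i <;> cases x' i <;> cases y i <;> simp

open Classical in
theorem card_not_isFar_le {n : ℕ} (hn : 64 ≤ n) (S : Finset (Cube n)) :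
    #{x : Cube n | ¬ IsFar (1 / 128) (stdSimplex.vertex x)
      (stdSimplex.vertex '' (S : Set (Cube n)))} ≤ #S * 2 ^ (12 * (n / 64) + 8) := by
  refine (card_le_card (t := S.biUnion fun y => {x : Cube n | hammingDist x y ≤ n / 64})
    fun x hx => ?_).trans (card_biUnion_le_card_mul _ _ _ fun y _ =>
      (card_ball_le y _).trans (card_small_sets_le n))
  by_contra hne
  refine (mem_filter.1 hx).2 (isFar_vertex (δ := 1 / 64) (by norm_num) (by norm_num) x _ ?_)
  intro y hy
  simp only [mem_biUnion, mem_filter, mem_univ, true_and, not_exists, not_and, not_le] at hne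
  have h1 := hne y hy
  have h2 : (n : ℝ) ≤ 64 * hammingDist x y := by exact_mod_cast (by omega)
  have h3 : (0 : ℝ) < n := by exact_mod_cast (by omega)
  rw [dH, le_div_iff₀ h3]
  linarith

theorem exists_hard_property {n : ℕ} (hn : 64 ≤ n) :
    ∃ S : Finset (Cube n),
      ¬ IndexInvariant (stdSimplex.vertex '' (S : Set (Cube n)) : Set (Dist n)) ∧
      ∀ (s q : ℕ) (A : Algorithm n s), A.QueriesAtMost q →
        A.EpsTests (1 / 128) (stdSimplex.vertex '' (S : Set (Cube n))) →
        1 / 64 * (n : ℝ) ≤ q := by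
  classical
  set a := n / 64 with ha
  -- The exponent exceeds that of `card_small_sets_le` by one, for the strict inequality.
  obtain ⟨ι, _, c, hι, hc⟩ := exists_code (12 * a + 9)
    {T : Finset (Fin n) | #T ≤ a ∧ T.Nonempty} (by simp) (by
      refine lt_of_le_of_lt ((card_le_card ?_).trans (card_small_sets_le n))
        (Nat.pow_lt_pow_right (by norm_num) (Nat.lt_succ_self _))
      exact monotone_filter_right _ fun T _ h => h.1)
  have hcard : #(univ.image c) ≤ 2 ^ (12 * a + 9) := by
    simpa [hι] using card_image_le (s := (univ : Finset ι)) (f := c)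
  have h2 : 2 ≤ 2 ^ (12 * a + 9) := Nat.le_self_pow (by omega) 2
  have hpow : 2 ^ (12 * a + 10) = 2 ^ (12 * a + 9) * 2 := pow_succ _ _
  have hlt : 2 ^ (12 * a + 10) < 2 ^ n := Nat.pow_lt_pow_right (by norm_num) (by omega)
  have hS0 : #(univ.image c) + 2 < 2 ^ n := by omega
  obtain ⟨S, hcS, hS, hinv⟩ := exists_not_indexInvariant (univ.image c) hS0
  refine ⟨S, hinv, fun s q A hA htest => ?_⟩
  by_contra! hq
  have hqa : q ≤ a := by
    have : 64 * (q : ℝ) < n := by linarith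
    have : 64 * q < n := by exact_mod_cast this
    omega
  have : Nonempty ι := Fintype.card_pos_iff.1 (hι ▸ by positivity)
  refine not_epsTests_of_code c (fun T hT hTq => hc T ?_)
    (stdSimplex.vertex '' (S : Set (Cube n)))
    (fun i => ⟨c i, hcS (mem_image_of_mem c (mem_univ i)), rfl⟩) ?_ A hA htest
  · simp [hT, hTq.trans hqa]
  · calc _ ≤ 2 * (#S * 2 ^ (12 * a + 8)) := Nat.mul_le_mul_left 2 (card_not_isFar_le hn S)
      _ ≤ 2 * (2 ^ (12 * a + 10) * 2 ^ (12 * a + 8)) := by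
          refine Nat.mul_le_mul_left 2 (Nat.mul_le_mul_right _ ?_)
          omega
      _ = 2 ^ (24 * a + 19) := by ring
      -- Here `n ≥ 64 * a` and `a ≥ 1`.
      _ < 2 ^ n := Nat.pow_lt_pow_right (by norm_num) (by omega)

end HugeObject

end

theorem proposition6p6 :
    ∃ P : (n : ℕ) → Set (HugeObject.Dist n),
      (∀ n, IsClosed (P n)) ∧
      (∀ n, ∀ D ∈ P n, (∃ x : HugeObject.Cube n, D = stdSimplex.vertex x) ∧
        HugeObject.vcDim D = 0) ∧
      (∃ n₀ : ℕ, ∀ n ≥ n₀, ¬ HugeObject.IndexInvariant (P n)) ∧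
      ∃ ε : ℝ, 0 < ε ∧ ε < 1 ∧ ∃ c : ℝ, 0 < c ∧ ∃ n₀ : ℕ, ∀ n ≥ n₀,
        ∀ (s q : ℕ) (A : HugeObject.Algorithm n s),
          A.QueriesAtMost q → A.EpsTests ε (P n) → c * (n : ℝ) ≤ (q : ℝ) := by
  have hex : ∀ n : ℕ, ∃ S : Finset (HugeObject.Cube n), 64 ≤ n →
      ¬ HugeObject.IndexInvariant
        (stdSimplex.vertex '' (S : Set (HugeObject.Cube n)) : Set (HugeObject.Dist n)) ∧
      ∀ (s q : ℕ) (A : HugeObject.Algorithm n s), A.QueriesAtMost q →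
        A.EpsTests (1 / 128) (stdSimplex.vertex '' (S : Set (HugeObject.Cube n))) →
        1 / 64 * (n : ℝ) ≤ q := by
    intro n
    by_cases hn : 64 ≤ n
    · obtain ⟨S, hS⟩ := HugeObject.exists_hard_property hn
      exact ⟨S, fun _ => hS⟩
    -- For `n < 64` the empty property serves as a default.
    · exact ⟨∅, fun h => absurd h hn⟩
  choose S hS using hex
  refine ⟨fun n => stdSimplex.vertex '' (S n : Set (HugeObject.Cube n)),
    fun n => ((S n).finite_toSet.image _).isClosed, ?_, ⟨64, fun n hn => (hS n hn).1⟩,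
    1 / 128, by norm_num, by norm_num, 1 / 64, by norm_num, 64, fun n hn => (hS n hn).2⟩
  rintro n _ ⟨x, -, rfl⟩
  exact ⟨⟨x, rfl⟩, HugeObject.vcDim_vertex x⟩
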